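/- Let $M$ be a smooth (Hausdorff, second countable, finite-dimensional) manifold without boundary and let $(A,[\cdot,\cdot],\rho)$ be a Lie algebroid over $M$. Write $\mathfrak X^{\mathrm{top}}(A)=\Gamma(\wedge^{\mathrm{top}}A)$ and $\Omega^1(A)=\Gamma(A^*)$. For non-vanishing sections $\eta\in\mathfrak X^{\mathrm{top}}(A)$ and $\mu\in\Omega^{\mathrm{top}}(M)$, the modular form of $A$ with respect to $\eta\otimes\mu$ is the form $\xi_A\in\Omega^1(A)$ determined by $$\langle \xi_A,X\rangle\,\eta\otimes\mu=\mathcal L_X\eta\otimes\mu+\eta\otimes\mathcal L_{\rho(X)}\mu,\qquad X\in\Gamma(A).$$ Let $N:A\to A$ be a Nijenhuis operator, that is, a smooth bundle map over the identity with $N[X,Y]_N=[NX,NY]$ for all $X,Y\in\Gamma(A)$, where $[X,Y]_N:=[NX,Y]+[X,NY]-N[X,Y]$, and let $A_N=(A,[\cdot,\cdot]_N,\rho\circ N)$ be the deformed Lie algebroid. Let $\langle N^*\xi,X\rangle=\langle\xi,NX\rangle$ and $\langle d_Af,X\rangle=\rho(X)\cdot f$. Then, for all non-vanishing $\eta\in\mathfrak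 X^{\mathrm{top}}(A)$ and $\mu\in\Omega^{\mathrm{top}}(M)$, the modular forms $\xi_A$ of $A$ and $\xi_{A_N}$ of $A_N$ with respect to $\eta\otimes\mu$ exist, are unique, and satisfy $$\xi_{A_N}=d_A(\mathrm{Tr}\,N)+N^*\xi_A .$$ In particular, $\xi_{A_N}-N^*\xi_A$ does not depend on the choice of the non-vanishing sections $\eta$ and $\mu$. -/

import Mathlib

open scoped Manifold ContDiff Bundle TensorProduct

noncomputable section

/-! ### Derivations of modules and their action on alternating forms -/

/-- An additive operator `D` on an `R`-module `P` that satisfies the Leibniz rule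
`D (f • p) = f • D p + δ f • p` over a derivation `δ` of `R` (its symbol). -/
structure ModuleDerivation (R P : Type*) [CommRing R] [Algebra ℝ R] [AddCommGroup P]
    [Module R P] where
  symbol : Derivation ℝ R R
  toAddHom : P →+ P
  leibniz : ∀ (f : R) (p : P), toAddHom (f • p) = f • toAddHom p + symbol f • p

namespace ModuleDerivation

variable {R P : Type*} [CommRing R] [Algebra ℝ R] [AddCommGroup P] [Module R P]

/-- The induced operator on the dual module: `(D α) p = δ (α p) - α (D p)`. -/
def dual (D : ModuleDerivation R P) : ModuleDerivation R (Module.Dual R P) where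
  symbol := D.symbol
  toAddHom :=
    { toFun := fun α =>
        { toFun := fun p => D.symbol (α p) - α (D.toAddHom p)
          map_add' := fun p q => by simp only [map_add]; abel
          map_smul' := fun f p => by
            simp only [map_smul, D.leibniz, map_add, smul_eq_mul, Derivation.leibniz,
              RingHom.id_apply]
            ring }
      map_zero' := by ext p; simp
      map_add' := fun α β => by
        ext p
        simp only [LinearMap.add_apply, LinearMap.coe_mk, AddHom.coe_mk, map_add]
        abel }
  leibniz := fun f α => by
    ext p
    simp only [AddMonoidHom.coe_mk, ZeroHom.coe_mk, LinearMap.coe_mk, AddHom.coe_mk,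
      LinearMap.add_apply, LinearMap.smul_apply, smul_eq_mul, Derivation.leibniz]
    ring

/-- The induced operator on alternating forms:
`(D θ) (p₁, …, pₖ) = δ (θ (p₁, …, pₖ)) - ∑ᵢ θ (p₁, …, D pᵢ, …, pₖ)`. -/
def onForms (D : ModuleDerivation R P) {k : ℕ} (θ : P [⋀^Fin k]→ₗ[R] R) :
    P [⋀^Fin k]→ₗ[R] R where
  toFun p := D.symbol (θ p) - ∑ i, θ (Function.update p i (D.toAddHom (p i)))
  map_update_add' := by
    intro inst p j a b
    obtain rfl : inst = instDecidableEqFin k := Subsingleton.elim _ _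
    have key : ∀ c : P, ∑ i, θ (Function.update (Function.update p j c) i
        (D.toAddHom (Function.update p j c i))) =
        θ (Function.update p j (D.toAddHom c)) + ∑ i ∈ Finset.univ.erase j,
          θ (Function.update (Function.update p i (D.toAddHom (p i))) j c) := by
      intro c
      rw [← Finset.add_sum_erase _ _ (Finset.mem_univ j)]
      congr 1
      · simp
      · refine Finset.sum_congr rfl fun i hi => ?_
        have hij : i ≠ j := (Finset.mem_erase.1 hi).1
        rw [Function.update_of_ne hij, Function.update_comm hij]
    simp only [key, map_add, AlternatingMap.map_update_add, Finset.sum_add_distrib]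
    abel
  map_update_smul' := by
    intro inst p j f a
    obtain rfl : inst = instDecidableEqFin k := Subsingleton.elim _ _
    have key : ∀ c : P, ∑ i, θ (Function.update (Function.update p j c) i
        (D.toAddHom (Function.update p j c i))) =
        θ (Function.update p j (D.toAddHom c)) + ∑ i ∈ Finset.univ.erase j,
          θ (Function.update (Function.update p i (D.toAddHom (p i))) j c) := by
      intro c
      rw [← Finset.add_sum_erase _ _ (Finset.mem_univ j)]
      congr 1
      · simp
      · refine Finset.sum_congr rfl fun i hi => ?_
        have hij : i ≠ j := (Finset.mem_erase.1 hi).1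
        rw [Function.update_of_ne hij, Function.update_comm hij]
    simp only [key, D.leibniz, AlternatingMap.map_update_add, AlternatingMap.map_update_smul,
      smul_eq_mul, Derivation.leibniz,
      ← Finset.mul_sum]
    ring
  map_eq_zero_of_eq' := by
    intro p a b hab hne
    have h0 : θ p = 0 := θ.map_eq_zero_of_eq p hab hne
    rw [h0, map_zero, zero_sub, neg_eq_zero]
    rw [← Finset.add_sum_erase _ _ (Finset.mem_univ a),
      ← Finset.add_sum_erase _ _ (Finset.mem_erase.2 ⟨hne.symm, Finset.mem_univ b⟩),
      Finset.sum_eq_zero, add_zero]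
    · have : Function.update p b (D.toAddHom (p b)) =
          (Function.update p a (D.toAddHom (p a))) ∘ Equiv.swap a b := by
        funext i
        rcases eq_or_ne i b with rfl | hib
        · simp [hab]
        · rcases eq_or_ne i a with rfl | hia
          · simp [hne, hab, Function.update_of_ne hne.symm]
          · simp [Equiv.swap_apply_of_ne_of_ne hia hib, hia, hib]
      rw [this, θ.map_swap _ hne, add_neg_cancel]
    · intro i hi
      simp only [Finset.mem_erase, Finset.mem_univ, and_true] at hi
      refine θ.map_eq_zero_of_eq _ (i := a) (j := b) ?_ hne
      rw [Function.update_of_ne (Ne.symm hi.2), Function.update_of_ne (Ne.symm hi.1), hab]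

end ModuleDerivation

/-! ### Smooth functions, sections and vector fields -/

section Bundles

variable {E : Type*} [NormedAddCommGroup E] [NormedSpace ℝ E]
  {H : Type*} [TopologicalSpace H] {I : ModelWithCorners ℝ E H}
  {M : Type*} [TopologicalSpace M] [ChartedSpace H M]
  {F : Type*} [NormedAddCommGroup F] [NormedSpace ℝ F]
  {V : M → Type*} [TopologicalSpace (Bundle.TotalSpace F V)]
  [∀ x, AddCommGroup (V x)] [∀ x, Module ℝ (V x)] [∀ x, TopologicalSpace (V x)]
  [FiberBundle F V] [VectorBundle ℝ F V]

/-- `(f • s) x = f x • s x`. -/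
instance smoothSectionSMul : SMul C^∞⟮I, M; ℝ⟯ Cₛ^∞⟮I; F, V⟯ :=
  ⟨fun f s => ⟨fun x => f x • s x, ContMDiff.smul_section f.contMDiff s.contMDiff⟩⟩

theorem smoothSection_smul_apply (f : C^∞⟮I, M; ℝ⟯) (s : Cₛ^∞⟮I; F, V⟯) (x : M) :
    (f • s) x = f x • s x := rfl

/-- The smooth sections of a vector bundle form a module over the smooth functions. -/
instance smoothSectionModule : Module C^∞⟮I, M; ℝ⟯ Cₛ^∞⟮I; F, V⟯ where
  one_smul s := by ext x; exact one_smul ℝ (s x)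
  mul_smul f g s := by ext x; exact mul_smul (f x) (g x) (s x)
  smul_zero f := by ext x; exact smul_zero (f x)
  smul_add f s t := by ext x; exact smul_add (f x) (s x) (t x)
  add_smul f g s := by ext x; exact add_smul (f x) (g x) (s x)
  zero_smul s := by ext x; exact zero_smul ℝ (s x)

variable (I M) in
/-- Smooth vector fields on `M`. -/
abbrev SmoothVectorField [IsManifold I ∞ M] : Type _ :=
  Cₛ^∞⟮I; E, (TangentSpace I : M → Type _)⟯

/-- A smooth vector field acting on smooth functions: `(Y · f) x = df_x (Y x)`. -/
def SmoothVectorField.derivation [IsManifold I ∞ M] (Y : SmoothVectorField I M) :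
    Derivation ℝ C^∞⟮I, M; ℝ⟯ C^∞⟮I, M; ℝ⟯ :=
  Derivation.mk'
    { toFun := fun f => ⟨fun x => mvfderiv I f x (Y x), by
        have h1 : ContMDiff I.tangent 𝓘(ℝ, ℝ).tangent ∞ (tangentMap I 𝓘(ℝ, ℝ) f) :=
          f.contMDiff.contMDiff_tangentMap (by simp)
        have h2 := h1.comp Y.contMDiff
        intro x
        have h3 := (Bundle.contMDiffAt_totalSpace.1 (h2 x)).2
        simpa [tangentMap, Function.comp_def] using! h3⟩
      map_add' := fun f g => by
        ext x
        have h := mvfderiv_add (f.contMDiff.mdifferentiable (by simp) x)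
          (g.contMDiff.mdifferentiable (by simp) x)
        exact congrArg (fun L => L (Y x)) h
      map_smul' := fun c f => by
        ext x
        have h := mvfderiv_smul (I := I) (x := x) (a := fun _ : M => c) mdifferentiableAt_const
          (f.contMDiff.mdifferentiable (by simp) x)
        rw [mvfderiv_const] at h
        have h' := congrArg (fun L => L (Y x)) h
        simpa using! h' }
    (fun f g => by
        ext x
        have h := mvfderiv_mul (f.contMDiff.mdifferentiable (by simp) x)
          (g.contMDiff.mdifferentiable (by simp) x)
        have h' := congrArg (fun L => L (Y x)) h
        simpa using! h')

/-- The Lie bracket of smooth vector fields. -/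
def SmoothVectorField.bracket [IsManifold I ∞ M] [CompleteSpace E]
    (X Y : SmoothVectorField I M) : SmoothVectorField I M :=
  ⟨VectorField.mlieBracket I X Y, by
    have : IsManifold I ((∞ : ℕ∞ω) + 1) M := ‹IsManifold I ∞ M›
    have : IsManifold I (minSmoothness ℝ 2) M := by
      rw [minSmoothness_of_isRCLikeNormedField]; infer_instance
    exact ContDiff.mlieBracket_vectorField (m := ⊤) (n := ⊤) X.contMDiff Y.contMDiff (by simp)⟩

/-- A form or multivector field, given as a multilinear map over the smooth functions, vanishes at
no point. -/
def AlternatingMap.IsNonvanishing {P : Type*} [AddCommGroup P] [Module C^∞⟮I, M; ℝ⟯ P] {k : ℕ}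
    (θ : P [⋀^Fin k]→ₗ[C^∞⟮I, M; ℝ⟯] C^∞⟮I, M; ℝ⟯) : Prop :=
  ∀ x : M, ∃ p : Fin k → P, θ p x ≠ 0

/-- `Y ↦ [X, Y]` on vector fields, a derivation with symbol `X`. -/
def SmoothVectorField.ad [IsManifold I ∞ M] [CompleteSpace E] (X : SmoothVectorField I M) :
    ModuleDerivation C^∞⟮I, M; ℝ⟯ (SmoothVectorField I M) where
  symbol := X.derivation
  toAddHom := AddMonoidHom.mk' (fun Y => X.bracket Y) fun Y Z => by
    ext x
    exact VectorField.mlieBracket_add_right (Y.contMDiff.mdifferentiable (by simp) x)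
      (Z.contMDiff.mdifferentiable (by simp) x)
  leibniz f Y := by
    ext x
    exact (VectorField.mlieBracket_smul_right (f.contMDiff.mdifferentiable (by simp) x)
      (Y.contMDiff.mdifferentiable (by simp) x)).trans (add_comm _ _)

variable (I M) in
/-- Differential forms of degree `k` on `M`, that is sections of `⋀ᵏ T^*M`, as alternating maps on
vector fields that are multilinear over the smooth functions. -/
abbrev DifferentialForm [IsManifold I ∞ M] (k : ℕ) : Type _ :=
  SmoothVectorField I M [⋀^Fin k]→ₗ[C^∞⟮I, M; ℝ⟯] C^∞⟮I, M; ℝ⟯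

/-- The Lie derivative of differential forms,
`(L_X θ)(Y₁, …, Yₖ) = X · θ(Y₁, …, Yₖ) - ∑ᵢ θ(Y₁, …, [X, Yᵢ], …, Yₖ)`. -/
def SmoothVectorField.lieDerivative [IsManifold I ∞ M] [CompleteSpace E]
    (X : SmoothVectorField I M) {k : ℕ} (θ : DifferentialForm I M k) : DifferentialForm I M k :=
  X.ad.onForms θ

end Bundles

/-! ### Lie algebroids -/

section Algebroids

set_option linter.unusedSectionVars false

variable {E : Type*} [NormedAddCommGroup E] [NormedSpace ℝ E] [FiniteDimensional ℝ E]
  {H : Type*} [TopologicalSpace H] (I : ModelWithCorners ℝ E H)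
  {M : Type*} [TopologicalSpace M] [ChartedSpace H M] [IsManifold I ∞ M]
  (F : Type*) [NormedAddCommGroup F] [NormedSpace ℝ F] [FiniteDimensional ℝ F]
  (V : M → Type*) [TopologicalSpace (Bundle.TotalSpace F V)]
  [∀ x, AddCommGroup (V x)] [∀ x, Module ℝ (V x)] [∀ x, TopologicalSpace (V x)]
  [∀ x, IsTopologicalAddGroup (V x)] [∀ x, ContinuousSMul ℝ (V x)]
  [FiberBundle F V] [VectorBundle ℝ F V] [ContMDiffVectorBundle ∞ F V I]

/-- Smooth bundle maps `V → V` over the identity of `M`. -/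
abbrev BundleEnd : Type _ := Cₛ^∞⟮I; F →L[ℝ] F, fun x => V x →L[ℝ] V x⟯

/-- A Lie algebroid structure on the smooth vector bundle `V → M`. -/
structure LieAlgebroid where
  /-- the anchor `ρ : V → TM`, a smooth bundle map over the identity -/
  anchor : Cₛ^∞⟮I; F →L[ℝ] E, fun x => V x →L[ℝ] TangentSpace I x⟯
  bracket : Cₛ^∞⟮I; F, V⟯ →ₗ[ℝ] Cₛ^∞⟮I; F, V⟯ →ₗ[ℝ] Cₛ^∞⟮I; F, V⟯
  bracket_self : ∀ X, bracket X X = 0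
  jacobi : ∀ X Y Z, bracket X (bracket Y Z) = bracket (bracket X Y) Z + bracket Y (bracket X Z)
  anchor_bracket : ∀ (X Y : Cₛ^∞⟮I; F, V⟯) (x : M), anchor x (bracket X Y x) =
    VectorField.mlieBracket I (fun y => anchor y (X y)) (fun y => anchor y (Y y)) x
  leibniz : ∀ (X Y : Cₛ^∞⟮I; F, V⟯) (f : C^∞⟮I, M; ℝ⟯) (x : M),
    bracket X (f • Y) x = f x • bracket X Y x + mvfderiv I f x (anchor x (X x)) • Y x

variable {I F V}

namespace BundleEnd

/-- The map `X ↦ N X` on sections. -/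
def onSections (N : BundleEnd I F V) : Cₛ^∞⟮I; F, V⟯ →ₗ[C^∞⟮I, M; ℝ⟯] Cₛ^∞⟮I; F, V⟯ where
  toFun X := ⟨fun x => N x (X x), N.contMDiff.clm_bundle_apply X.contMDiff⟩
  map_add' X Y := by ext x; exact map_add (N x) (X x) (Y x)
  map_smul' f X := by ext x; exact map_smul (N x) (f x) (X x)

/-- The transpose `N^*` on `1`-forms: `⟨N^* ξ, X⟩ = ⟨ξ, N X⟩`. -/
def transpose (N : BundleEnd I F V) (ξ : Module.Dual C^∞⟮I, M; ℝ⟯ Cₛ^∞⟮I; F, V⟯) :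
    Module.Dual C^∞⟮I, M; ℝ⟯ Cₛ^∞⟮I; F, V⟯ :=
  ξ ∘ₗ N.onSections

/-- The function `x ↦ Tr (N x)`. -/
def trace (N : BundleEnd I F V) : C^∞⟮I, M; ℝ⟯ :=
  ⟨fun x => LinearMap.trace ℝ (V x) (N x : V x →ₗ[ℝ] V x), by
    intro x₀
    have h := ((contMDiffAt_hom_bundle _).1 (N.contMDiff x₀)).2
    let T : (F →L[ℝ] F) →L[ℝ] ℝ := LinearMap.toContinuousLinearMap
      (LinearMap.trace ℝ F ∘ₗ ContinuousLinearMap.coeLM ℝ)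
    have h2 := T.contDiff.contMDiff.contMDiffAt.comp x₀ h
    refine h2.congr_of_eventuallyEq ?_
    filter_upwards [(trivializationAt F V x₀).open_baseSet.mem_nhds
      (FiberBundle.mem_baseSet_trivializationAt' x₀)] with x hx
    simp only [Function.comp_apply]
    rw [ContinuousLinearMap.inCoordinates_eq hx hx]
    exact (LinearMap.trace_conj' (N x : V x →ₗ[ℝ] V x)
      ((trivializationAt F V x₀).continuousLinearEquivAt ℝ x hx).toLinearEquiv).symm⟩

end BundleEnd

namespace LieAlgebroid

variable (A : LieAlgebroid I F V)

/-- The vector field `ρ(X)`. -/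
def anchorField (X : Cₛ^∞⟮I; F, V⟯) : SmoothVectorField I M :=
  ⟨fun x => A.anchor x (X x), A.anchor.contMDiff.clm_bundle_apply X.contMDiff⟩

/-- `A`-forms of degree one. -/
abbrev OneForms (_A : LieAlgebroid I F V) : Type _ :=
  Module.Dual C^∞⟮I, M; ℝ⟯ Cₛ^∞⟮I; F, V⟯

/-- `A`-multivector fields of degree `k`, that is sections of `⋀ᵏ A`, as alternating maps on
one-forms that are multilinear over the smooth functions. -/
abbrev Multivectors (A : LieAlgebroid I F V) (k : ℕ) : Type _ :=
  A.OneForms [⋀^Fin k]→ₗ[C^∞⟮I, M; ℝ⟯] C^∞⟮I, M; ℝ⟯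

/-- The differential of a function: `⟨d_A f, X⟩ = ρ(X) · f`. -/
def d (f : C^∞⟮I, M; ℝ⟯) : A.OneForms where
  toFun X := (A.anchorField X).derivation f
  map_add' X Y := by ext x; exact (by simp :
    mvfderiv I f x (A.anchor x (X x + Y x)) = mvfderiv I f x (A.anchor x (X x)) +
      mvfderiv I f x (A.anchor x (Y x)))
  map_smul' g X := by ext x; exact (by simp :
    mvfderiv I f x (A.anchor x (g x • X x)) = g x * mvfderiv I f x (A.anchor x (X x)))

/-- `Y ↦ [X, Y]`, a derivation with symbol `ρ(X)`. -/
def ad (X : Cₛ^∞⟮I; F, V⟯) : ModuleDerivation C^∞⟮I, M; ℝ⟯ Cₛ^∞⟮I; F, V⟯ where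
  symbol := (A.anchorField X).derivation
  toAddHom := (A.bracket X).toAddMonoidHom
  leibniz f Y := by ext x; exact A.leibniz X Y f x

/-- The Lie derivative `L_X P = [X, P]` of `A`-multivector fields,
`(L_X P)(α₁, …, αₖ) = ρ(X) · P(α₁, …, αₖ) - ∑ᵢ P(α₁, …, L_X αᵢ, …, αₖ)`, where
`⟨L_X α, Y⟩ = ρ(X) · ⟨α, Y⟩ - ⟨α, [X, Y]⟩`. -/
def lieDerivative (X : Cₛ^∞⟮I; F, V⟯) {k : ℕ} (P : A.Multivectors k) : A.Multivectors k :=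
  (A.ad X).dual.onForms P

/-! #### Deformation by a Nijenhuis operator -/

/-- `[X, Y]_N = [N X, Y] + [X, N Y] - N [X, Y]`. -/
def deformedBracket (N : BundleEnd I F V) (X Y : Cₛ^∞⟮I; F, V⟯) : Cₛ^∞⟮I; F, V⟯ :=
  A.bracket (N.onSections X) Y + A.bracket X (N.onSections Y) - N.onSections (A.bracket X Y)

/-- `N` is a Nijenhuis operator: its torsion `N [X, Y]_N - [N X, N Y]` vanishes. -/
def IsNijenhuis (N : BundleEnd I F V) : Prop :=
  ∀ X Y, N.onSections (A.deformedBracket N X Y) - A.bracket (N.onSections X) (N.onSections Y) = 0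

theorem bracket_skew (X Y : Cₛ^∞⟮I; F, V⟯) : A.bracket X Y = -A.bracket Y X := by
  have h := A.bracket_self (X + Y)
  simp only [map_add, LinearMap.add_apply, A.bracket_self, zero_add, add_zero] at h
  exact eq_neg_of_add_eq_zero_right h

theorem onSections_smul_real (N : BundleEnd I F V) (c : ℝ) (X : Cₛ^∞⟮I; F, V⟯) :
    N.onSections (c • X) = c • N.onSections X := by
  ext x; exact map_smul (N x) c (X x)

/-- The deformed Lie algebroid `A_N`, with bracket `[·, ·]_N` and anchor `ρ ∘ N`. -/
def deform (N : BundleEnd I F V) (hN : A.IsNijenhuis N) : LieAlgebroid I F V where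
  anchor := ⟨fun x => (A.anchor x).comp (N x), by
    intro x₀
    have h1 := ((contMDiffAt_hom_bundle _).1 (N.contMDiff x₀)).2
    have h2 := ((contMDiffAt_hom_bundle _).1 (A.anchor.contMDiff x₀)).2
    refine (contMDiffAt_hom_bundle _).2 ⟨contMDiffAt_id, ?_⟩
    refine (h2.clm_comp h1).congr_of_eventuallyEq ?_
    filter_upwards [(trivializationAt F V x₀).open_baseSet.mem_nhds
      (FiberBundle.mem_baseSet_trivializationAt' x₀),
      (trivializationAt E (TangentSpace I : M → Type _) x₀).open_baseSet.mem_nhds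
      (FiberBundle.mem_baseSet_trivializationAt' x₀)] with x hx hx'
    rw [ContinuousLinearMap.inCoordinates_eq hx hx', ContinuousLinearMap.inCoordinates_eq hx hx',
      ContinuousLinearMap.inCoordinates_eq hx hx]
    ext v
    simp only [ContinuousLinearMap.comp_apply, ContinuousLinearEquiv.coe_coe,
      ContinuousLinearEquiv.symm_apply_apply]⟩
  bracket := LinearMap.mk₂ ℝ (A.deformedBracket N)
    (fun X Y Z => by
      simp only [deformedBracket, map_add, LinearMap.add_apply]; abel)
    (fun c X Y => by
      simp only [deformedBracket, map_smul, onSections_smul_real, LinearMap.smul_apply, smul_add,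
        smul_sub])
    (fun X Y Z => by
      simp only [deformedBracket, map_add]; abel)
    (fun c X Y => by
      simp only [deformedBracket, map_smul, onSections_smul_real, smul_add, smul_sub])
  bracket_self X := by
    simp only [LinearMap.mk₂_apply, deformedBracket, A.bracket_self, map_zero, sub_zero]
    rw [A.bracket_skew, neg_add_cancel]
  jacobi X Y Z := by
    have key : ∀ X Y, A.bracket (N.onSections X) (N.onSections Y) =
        N.onSections (A.deformedBracket N X Y) := fun X Y => (sub_eq_zero.1 (hN X Y)).symm
    have k2 : ∀ X Y, A.bracket (N.onSections X) (N.onSections Y) =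
        N.onSections (A.bracket (N.onSections X) Y) + N.onSections (A.bracket X (N.onSections Y)) -
          N.onSections (N.onSections (A.bracket X Y)) := fun X Y => by
      rw [key, deformedBracket, map_sub, map_add]
    have hd : ∀ X Y, A.deformedBracket N X Y = A.bracket (N.onSections X) Y +
        A.bracket X (N.onSections Y) - N.onSections (A.bracket X Y) := fun _ _ => rfl
    simp only [LinearMap.mk₂_apply]
    rw [hd X (A.deformedBracket N Y Z), hd (A.deformedBracket N X Y) Z,
      hd Y (A.deformedBracket N X Z), ← key, ← key, ← key]
    simp only [deformedBracket, map_add, map_sub, LinearMap.add_apply, LinearMap.sub_apply]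
    rw [k2 X (A.bracket Y Z), k2 (A.bracket X Y) Z, k2 Y (A.bracket X Z)]
    rw [A.jacobi (N.onSections X) (N.onSections Y) Z, A.jacobi (N.onSections X) Y (N.onSections Z),
      A.jacobi X (N.onSections Y) (N.onSections Z), A.jacobi (N.onSections X) Y Z,
      A.jacobi X (N.onSections Y) Z, A.jacobi X Y (N.onSections Z), A.jacobi X Y Z]
    simp only [map_add]
    abel
  anchor_bracket X Y x := by
    have h := congrArg (fun Z : Cₛ^∞⟮I; F, V⟯ => A.anchor x (Z x)) (sub_eq_zero.1 (hN X Y))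
    exact h.trans (A.anchor_bracket (N.onSections X) (N.onSections Y) x)
  leibniz X Y f x := by
    have h1 := A.leibniz (N.onSections X) Y f x
    have h2 := A.leibniz X (N.onSections Y) f x
    have h3 : N x (A.bracket X (f • Y) x) = f x • N x (A.bracket X Y x) +
        mvfderiv I f x (A.anchor x (X x)) • N x (Y x) := by
      rw [A.leibniz X Y f x, map_add, map_smul, map_smul]
    rw [← LinearMap.map_smul] at h2
    change A.bracket (N.onSections X) (f • Y) x + A.bracket X (N.onSections (f • Y)) x -
      N x (A.bracket X (f • Y) x) = f x • (A.bracket (N.onSections X) Y x +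
        A.bracket X (N.onSections Y) x - N x (A.bracket X Y x)) +
        mvfderiv I f x (A.anchor x (N x (X x))) • Y x
    rw [h3, h2, h1]
    change _ + mvfderiv I f x (A.anchor x (N x (X x))) • Y x +
      (_ + mvfderiv I f x (A.anchor x (X x)) • N x (Y x)) - _ = _
    module

/-! #### Modular forms -/

/-- `ξ` is the modular form of `A` with respect to `η ⊗ μ`: for all sections `X` of `A`,
`⟨ξ, X⟩ η ⊗ μ = L_X η ⊗ μ + η ⊗ L_{ρ(X)} μ`. -/
def IsModularForm (η : A.Multivectors (Module.finrank ℝ F))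
    (μ : DifferentialForm I M (Module.finrank ℝ E)) (ξ : A.OneForms) : Prop :=
  ∀ X : Cₛ^∞⟮I; F, V⟯,
    ξ X • (η ⊗ₜ[C^∞⟮I, M; ℝ⟯] μ) =
      A.lieDerivative X η ⊗ₜ[C^∞⟮I, M; ℝ⟯] μ +
        η ⊗ₜ[C^∞⟮I, M; ℝ⟯] (A.anchorField X).lieDerivative μ

end LieAlgebroid

end Algebroids
end

noncomputable section

/-! ### Partial dual bases -/

/-- Vectors `e i` and functionals `ε i` that form a pair of dual bases of the `R`-module `P` after
the scalar `χ` has been inverted. -/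
structure PartialDualBasis (R P : Type*) [CommRing R] [AddCommGroup P] [Module R P] (n : ℕ) where
  e : Fin n → P
  ε : Fin n → Module.Dual R P
  χ : R
  sum_smul : ∀ p, ∑ i, ε i p • e i = χ • p

namespace PartialDualBasis

variable {R P : Type*} [CommRing R] [AddCommGroup P] [Module R P] {n : ℕ}

/-- The corresponding partial dual basis of the dual module. -/
def dual (B : PartialDualBasis R P n) : PartialDualBasis R (Module.Dual R P) n where
  e := B.ε
  ε i := Module.Dual.eval R P (B.e i)
  χ := B.χ
  sum_smul α := by
    ext p
    have h := congrArg α (B.sum_smul p)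
    simp only [map_sum, map_smul, smul_eq_mul] at h
    simp only [LinearMap.sum_apply, LinearMap.smul_apply, Module.Dual.eval_apply, smul_eq_mul, ← h]
    exact Finset.sum_congr rfl fun i _ => mul_comm _ _

theorem det_mul (B : PartialDualBasis R P n) (θ : P [⋀^Fin n]→ₗ[R] R) (p : Fin n → P) :
    B.χ ^ n * θ p = Matrix.det (Matrix.of fun i j => B.ε j (p i)) * θ B.e := by
  have h := (θ.compLinearMap (Fintype.linearCombination R B.e)).eq_smul_basis_det
    (Pi.basisFun R (Fin n))
  have h' := congrArg (fun ζ => ζ fun i j => B.ε j (p i)) h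
  have h1 : ∀ i, Fintype.linearCombination R B.e (fun j => B.ε j (p i)) = B.χ • p i := fun i => by
    rw [Fintype.linearCombination_apply, B.sum_smul]
  simp only [AlternatingMap.compLinearMap_apply, AlternatingMap.smul_apply, h1, Pi.basisFun_apply,
    Fintype.linearCombination_apply_single, one_smul, smul_eq_mul] at h'
  have h2 := θ.toMultilinearMap.map_smul_univ (fun _ => B.χ) p
  simp only [AlternatingMap.coe_multilinearMap, Finset.prod_const, Finset.card_univ,
    Fintype.card_fin, smul_eq_mul] at h2
  rw [← h2, h', mul_comm, Pi.basisFun_det_apply]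

/-- Two top degree forms are proportional. -/
theorem pow_mul_cross (B : PartialDualBasis R P n) (θ θ' : P [⋀^Fin n]→ₗ[R] R) (p p' : Fin n → P) :
    (B.χ ^ n * B.χ ^ n) * (θ p * θ' p') = (B.χ ^ n * B.χ ^ n) * (θ p' * θ' p) := by
  have h1 := B.det_mul θ p
  have h2 := B.det_mul θ' p'
  have h3 := B.det_mul θ p'
  have h4 := B.det_mul θ' p
  calc _ = (B.χ ^ n * θ p) * (B.χ ^ n * θ' p') := by ring
    _ = (B.χ ^ n * θ p') * (B.χ ^ n * θ' p) := by rw [h1, h2, h3, h4]; ring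
    _ = _ := by ring

theorem sum_rankOne (B : PartialDualBasis R P n) (φ : Module.Dual R P) (X : P) :
    ∑ i, B.ε i (φ.smulRight X (B.e i)) = B.χ * φ X := by
  have h := congrArg φ (B.sum_smul X)
  simp only [map_sum, map_smul, smul_eq_mul] at h
  simp only [LinearMap.smulRight_apply, map_smul, smul_eq_mul, ← h]
  exact Finset.sum_congr rfl fun i _ => mul_comm _ _

variable [Algebra ℝ R]

/-- An endomorphism, as a derivation with vanishing symbol. -/
def _root_.ModuleDerivation.ofLinearMap (S : P →ₗ[R] P) : ModuleDerivation R P where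
  symbol := 0
  toAddHom := S.toAddMonoidHom
  leibniz f p := by simp

/-- An endomorphism acts on top degree forms by its trace. -/
theorem pow_mul_sum_update (B : PartialDualBasis R P n) (θ : P [⋀^Fin n]→ₗ[R] R) (S : P →ₗ[R] P)
    (p : Fin n → P) :
    (B.χ ^ n * B.χ) * ∑ i, θ (Function.update p i (S (p i))) =
      (B.χ ^ n * ∑ i, B.ε i (S (B.e i))) * θ p := by
  have hneg : ∀ q, (ModuleDerivation.ofLinearMap S).onForms θ q =
      -∑ i, θ (Function.update q i (S (q i))) := fun q => by
    change (0 : Derivation ℝ R R) (θ q) - _ = _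
    simp [ModuleDerivation.ofLinearMap]
  have hdet := B.det_mul ((ModuleDerivation.ofLinearMap S).onForms θ) p
  rw [hneg, hneg] at hdet
  have hterm : ∀ i, B.χ * θ (Function.update B.e i (S (B.e i))) =
      B.ε i (S (B.e i)) * θ B.e := fun i => by
    rw [← smul_eq_mul, ← AlternatingMap.map_update_smul, ← B.sum_smul,
      AlternatingMap.map_update_sum, Finset.sum_eq_single i]
    · rw [AlternatingMap.map_update_smul, Function.update_eq_self, smul_eq_mul]
    · intro j _ hji
      rw [AlternatingMap.map_update_smul, θ.map_update_self _ hji.symm, smul_zero]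
    · simp
  have hsum : B.χ * ∑ i, θ (Function.update B.e i (S (B.e i))) =
      (∑ i, B.ε i (S (B.e i))) * θ B.e := by
    rw [Finset.mul_sum, Finset.sum_mul]
    exact Finset.sum_congr rfl fun i _ => hterm i
  have hp := B.det_mul θ p
  linear_combination (-B.χ) * hdet +
    Matrix.det (Matrix.of fun i j => B.ε j (p i)) * hsum - (∑ i, B.ε i (S (B.e i))) * hp

end PartialDualBasis

namespace ModuleDerivation

variable {R P : Type*} [CommRing R] [Algebra ℝ R] [AddCommGroup P] [Module R P]

/-- The commutator of a derivation with an endomorphism. -/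
def commutator (D : ModuleDerivation R P) (N : P →ₗ[R] P) : P →ₗ[R] P where
  toFun p := D.toAddHom (N p) - N (D.toAddHom p)
  map_add' p q := by simp only [map_add]; abel
  map_smul' f p := by
    simp only [map_smul, D.leibniz, map_add, RingHom.id_apply, smul_sub]; abel

theorem dual_apply (D : ModuleDerivation R P) (α : Module.Dual R P) (p : P) :
    D.dual.toAddHom α p = D.symbol (α p) - α (D.toAddHom p) := rfl

theorem onForms_apply (D : ModuleDerivation R P) {k : ℕ} (θ : P [⋀^Fin k]→ₗ[R] R) (p : Fin k → P) :
    D.onForms θ p = D.symbol (θ p) - ∑ i, θ (Function.update p i (D.toAddHom (p i))) := rfl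

/-- The trace of the commutator `[D, N]` is the derivative of the trace of `N`. -/
theorem mul_sum_commutator {n : ℕ} (D : ModuleDerivation R P) (B : PartialDualBasis R P n)
    (N : P →ₗ[R] P) (τ : R) (hτ : ∑ i, B.ε i (N (B.e i)) = B.χ * τ) :
    B.χ * ∑ i, B.ε i (D.commutator N (B.e i)) = B.χ * (B.χ * D.symbol τ) := by
  have hW : ∀ p, ∑ i, (D.dual.toAddHom (B.ε i) p • B.e i + B.ε i p • D.toAddHom (B.e i)) =
      D.symbol B.χ • p := fun p => by
    have h := congrArg D.toAddHom (B.sum_smul p)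
    rw [map_sum, D.leibniz] at h
    have h2 := B.sum_smul (D.toAddHom p)
    rw [← h2] at h
    rw [← sub_eq_iff_eq_add', ← Finset.sum_sub_distrib] at h
    rw [← h]
    refine Finset.sum_congr rfl fun i _ => ?_
    rw [D.leibniz, dual_apply, sub_smul]
    abel
  have hcontr : ∀ (φ : Module.Dual R P) (p : P),
      B.χ * φ (N p) = ∑ j, B.ε j (N (φ (B.e j) • p)) := fun φ p => by
    rw [← smul_eq_mul, ← map_smul, ← B.sum_smul, map_sum]
    exact Finset.sum_congr rfl fun j _ => by simp only [map_smul, smul_eq_mul]; ring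
  have hWN : B.χ * ∑ i, (D.dual.toAddHom (B.ε i) (N (B.e i)) + B.ε i (N (D.toAddHom (B.e i)))) =
      D.symbol B.χ * (B.χ * τ) := by
    rw [Finset.mul_sum]
    simp only [mul_add, hcontr, ← Finset.sum_add_distrib, ← map_add]
    rw [Finset.sum_comm, ← hτ, Finset.mul_sum]
    refine Finset.sum_congr rfl fun j _ => ?_
    rw [← map_sum, ← map_sum, hW, map_smul, map_smul, smul_eq_mul]
  have hδ := congrArg D.symbol hτ
  rw [map_sum, Derivation.leibniz, smul_eq_mul, smul_eq_mul] at hδ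
  have hsum : ∑ i, B.ε i (D.commutator N (B.e i)) = ∑ i, D.symbol (B.ε i (N (B.e i))) -
      ∑ i, (D.dual.toAddHom (B.ε i) (N (B.e i)) + B.ε i (N (D.toAddHom (B.e i)))) := by
    rw [← Finset.sum_sub_distrib]
    refine Finset.sum_congr rfl fun i _ => ?_
    rw [dual_apply]
    change B.ε i (D.toAddHom (N (B.e i)) - N (D.toAddHom (B.e i))) = _
    rw [map_sub]
    ring
  rw [hsum, hδ]
  linear_combination -hWN

/-- If `D' = f D + S`, where the endomorphism `S` acts on the form `θ` by the scalar `-t`, then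
`D' θ = f (D θ) + t θ`. -/
theorem onForms_eq_smul_add {D D' : ModuleDerivation R P} {f t : R} {S : P →ₗ[R] P} {k : ℕ}
    {θ : P [⋀^Fin k]→ₗ[R] R} (hsymbol : D'.symbol = f • D.symbol)
    (hD : ∀ p, D'.toAddHom p = f • D.toAddHom p + S p)
    (hS : ∀ p, ∑ i, θ (Function.update p i (S (p i))) = -t * θ p) :
    D'.onForms θ = f • D.onForms θ + t • θ := by
  ext p
  simp only [onForms_apply, AlternatingMap.add_apply, AlternatingMap.smul_apply, hD,
    AlternatingMap.map_update_add, AlternatingMap.map_update_smul, Finset.sum_add_distrib, hS,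
    hsymbol, Derivation.smul_apply, ← Finset.mul_sum, smul_eq_mul]
  ring

/-- If `D'' = D + D'`, then `D'' θ = D θ + D' θ`. -/
theorem onForms_eq_add {D D' D'' : ModuleDerivation R P} {k : ℕ} (θ : P [⋀^Fin k]→ₗ[R] R)
    (hsymbol : D''.symbol = D.symbol + D'.symbol)
    (hD : ∀ p, D''.toAddHom p = D.toAddHom p + D'.toAddHom p) :
    D''.onForms θ = D.onForms θ + D'.onForms θ := by
  ext p
  simp only [onForms_apply, AlternatingMap.add_apply, hD, AlternatingMap.map_update_add,
    Finset.sum_add_distrib, hsymbol, Derivation.add_apply]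
  ring

end ModuleDerivation

section PartialFrames

open Filter Topology

variable {E : Type*} [NormedAddCommGroup E] [NormedSpace ℝ E] [FiniteDimensional ℝ E]
  {H : Type*} [TopologicalSpace H] {I : ModelWithCorners ℝ E H}
  {M : Type*} [TopologicalSpace M] [ChartedSpace H M] [IsManifold I ∞ M] [T2Space M]
  {F : Type*} [NormedAddCommGroup F] [NormedSpace ℝ F] [FiniteDimensional ℝ F]
  {V : M → Type*} [TopologicalSpace (Bundle.TotalSpace F V)]
  [∀ x, AddCommGroup (V x)] [∀ x, Module ℝ (V x)] [∀ x, TopologicalSpace (V x)]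
  [∀ x, IsTopologicalAddGroup (V x)] [∀ x, ContinuousSMul ℝ (V x)]
  [FiberBundle F V] [VectorBundle ℝ F V] [ContMDiffVectorBundle ∞ F V I]

omit [FiniteDimensional ℝ E] [IsManifold I ∞ M] [T2Space M]
  [∀ x, IsTopologicalAddGroup (V x)] [∀ x, ContinuousSMul ℝ (V x)] in
theorem contMDiff_mul_localFrameCoeff [ContMDiffVectorBundle 1 F V I] {ι : Type*}
    (b : Module.Basis ι ℝ F)
    (e : Bundle.Trivialization F (Bundle.TotalSpace.proj : Bundle.TotalSpace F V → M))
    [MemTrivializationAtlas e] {f : M → ℝ} (hf : ContMDiff I 𝓘(ℝ, ℝ) ∞ f)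
    (hsupp : tsupport f ⊆ e.baseSet) (X : Cₛ^∞⟮I; F, V⟯) (i : ι) :
    ContMDiff I 𝓘(ℝ, ℝ) ∞ fun x => f x * e.localFrameCoeff I b i x (X x) := by
  intro x
  by_cases hx : x ∈ e.baseSet
  · exact (hf x).mul (contMDiffAt_localFrameCoeff b hx (X.contMDiff x) i)
  · have h0 : f =ᶠ[𝓝 x] 0 := notMem_tsupport_iff_eventuallyEq.1 fun h => hx (hsupp h)
    refine (contMDiffAt_const (c := (0 : ℝ))).congr_of_eventuallyEq ?_
    filter_upwards [h0] with y hy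
    simp [hy]

/-- Near every point, the sections of a vector bundle have a partial dual basis, and it computes the
fibrewise traces of bundle endomorphisms. -/
theorem exists_partialDualBasis_sections (x₀ : M) :
    ∃ B : PartialDualBasis C^∞⟮I, M; ℝ⟯ Cₛ^∞⟮I; F, V⟯ (Module.finrank ℝ F), B.χ x₀ ≠ 0 ∧
      ∀ N : BundleEnd I F V, ∑ i, B.ε i (N.onSections (B.e i)) = B.χ * N.trace := by
  have : ContMDiffVectorBundle 1 F V I := ContMDiffVectorBundle.of_le (n := ∞) (by simp)
  classical
  let e := trivializationAt F V x₀
  let b := Module.finBasis ℝ F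
  obtain ⟨f, -, hf⟩ := ((SmoothBumpFunction.nhds_basis_tsupport (I := I) x₀).mem_iff).1
    (e.open_baseSet.mem_nhds (FiberBundle.mem_baseSet_trivializationAt' x₀))
  have hrep : ∀ (x : M) (v : V x),
      ∑ i, (f x * e.localFrameCoeff I b i x v) • (f x • e.localFrame b i x) = (f x * f x) • v := by
    intro x v
    by_cases hx : x ∈ e.baseSet
    · have h := (e.isLocalFrameOn_localFrame_baseSet I 1 b).coeff_sum_eq
        (Function.update (fun y => (0 : V y)) x v) hx
      rw [Function.update_self] at h
      conv_rhs => rw [h, Finset.smul_sum]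
      refine Finset.sum_congr rfl fun i _ => ?_
      rw [smul_smul, smul_smul]
      congr 1
      change f x * (e.isLocalFrameOn_localFrame_baseSet I 1 b).coeff i x v * f x = _
      ring
    · have h0 : f x = 0 := image_eq_zero_of_notMem_tsupport fun h => hx (hf h)
      simp [h0]
  let B : PartialDualBasis C^∞⟮I, M; ℝ⟯ Cₛ^∞⟮I; F, V⟯ (Module.finrank ℝ F) :=
    { e := fun i => ⟨fun x => f x • e.localFrame b i x,
        ContMDiffOn.smul_section_of_tsupport f.contMDiff.contMDiffOn e.open_baseSet hf
          (e.contMDiffOn_localFrame_baseSet ∞ b i)⟩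
      ε := fun i =>
        { toFun := fun X => ⟨fun x => f x * e.localFrameCoeff I b i x (X x),
            contMDiff_mul_localFrameCoeff b e f.contMDiff hf X i⟩
          map_add' := fun X Y => by
            ext x
            change f x * e.localFrameCoeff I b i x (X x + Y x) =
              f x * e.localFrameCoeff I b i x (X x) + f x * e.localFrameCoeff I b i x (Y x)
            rw [map_add, mul_add]
          map_smul' := fun g X => by
            ext x
            change f x * e.localFrameCoeff I b i x (g x • X x) =
              g x * (f x * e.localFrameCoeff I b i x (X x))
            rw [map_smul, smul_eq_mul]
            ring }
      χ := ⟨f, f.contMDiff⟩ * ⟨f, f.contMDiff⟩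
      sum_smul := fun X => by
        ext x
        refine Eq.trans ?_ (hrep x (X x))
        exact (map_sum (⟨⟨fun s : Cₛ^∞⟮I; F, V⟯ => s x, rfl⟩, fun _ _ => rfl⟩ :
          Cₛ^∞⟮I; F, V⟯ →+ V x) _ _) }
  refine ⟨B, ?_, fun N => ?_⟩
  · change f x₀ * f x₀ ≠ 0
    simp
  · ext x
    refine (map_sum ((Pi.evalRingHom (fun _ : M => ℝ) x).comp ContMDiffMap.coeFnRingHom)
      (fun i => B.ε i (N.onSections (B.e i))) Finset.univ).trans ?_
    change ∑ i, f x * e.localFrameCoeff I b i x (N x (f x • e.localFrame b i x)) =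
      (f x * f x) * LinearMap.trace ℝ (V x) (N x : V x →ₗ[ℝ] V x)
    by_cases hx : x ∈ e.baseSet
    · have : Module.Free ℝ (V x) := Module.Free.of_basis (e.basisAt b hx)
      have : Module.Finite ℝ (V x) := Module.Finite.of_basis (e.basisAt b hx)
      have hN : (f x * f x) • (N x : V x →ₗ[ℝ] V x) = ∑ i,
          (f x • e.localFrameCoeff I b i x).smulRight (N x (f x • e.localFrame b i x)) := by
        ext v
        rw [LinearMap.sum_apply, LinearMap.smul_apply]
        have h := congrArg (N x) (hrep x v)
        rw [map_sum, map_smul] at h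
        refine h.symm.trans (Finset.sum_congr rfl fun i _ => ?_)
        rw [map_smul]
        rfl
      rw [← smul_eq_mul (f x * f x), ← map_smul, hN, map_sum]
      refine Finset.sum_congr rfl fun i _ => ?_
      rw [LinearMap.trace_smulRight]
      rfl
    · have h0 : f x = 0 := image_eq_zero_of_notMem_tsupport fun h => hx (hf h)
      simp [h0]

end PartialFrames

section TopForms

variable {E : Type*} [NormedAddCommGroup E] [NormedSpace ℝ E]
  {H : Type*} [TopologicalSpace H] {I : ModelWithCorners ℝ E H}
  {M : Type*} [TopologicalSpace M] [ChartedSpace H M]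
  {P : Type*} [AddCommGroup P] [Module C^∞⟮I, M; ℝ⟯ P] {n : ℕ}

/-- The module `P` has partial dual bases of size `n` near every point. -/
def HasPartialDualBases (I : ModelWithCorners ℝ E H) {M : Type*} [TopologicalSpace M]
    [ChartedSpace H M] (P : Type*) [AddCommGroup P] [Module C^∞⟮I, M; ℝ⟯ P] (n : ℕ) : Prop :=
  ∀ x : M, ∃ B : PartialDualBasis C^∞⟮I, M; ℝ⟯ P n, B.χ x ≠ 0

theorem HasPartialDualBases.dual (h : HasPartialDualBases I (M := M) P n) :
    HasPartialDualBases I (M := M) (Module.Dual C^∞⟮I, M; ℝ⟯ P) n := fun x =>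
  let ⟨B, hB⟩ := h x
  ⟨B.dual, hB⟩

theorem ContMDiffMap.pow_apply_real (f : C^∞⟮I, M; ℝ⟯) (k : ℕ) (x : M) :
    (f ^ k) x = f x ^ k := by
  rw [ContMDiffMap.coe_pow]
  rfl

/-- Every form of top degree is a multiple of a given nonvanishing one. -/
theorem AlternatingMap.IsNonvanishing.exists_eq_smul (h : HasPartialDualBases I (M := M) P n)
    {θ : P [⋀^Fin n]→ₗ[C^∞⟮I, M; ℝ⟯] C^∞⟮I, M; ℝ⟯} (hθ : θ.IsNonvanishing)
    (θ' : P [⋀^Fin n]→ₗ[C^∞⟮I, M; ℝ⟯] C^∞⟮I, M; ℝ⟯) : ∃ g : C^∞⟮I, M; ℝ⟯, θ' = g • θ := by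
  have hcross : ∀ p q x, θ p x * θ' q x = θ q x * θ' p x := by
    intro p q x
    obtain ⟨B, hB⟩ := h x
    have h1 := congrArg (fun f : C^∞⟮I, M; ℝ⟯ => f x) (B.pow_mul_cross θ θ' p q)
    simp only [ContMDiffMap.coe_mul, Pi.mul_apply, ContMDiffMap.pow_apply_real] at h1
    exact mul_left_cancel₀ (mul_ne_zero (pow_ne_zero _ hB) (pow_ne_zero _ hB)) h1
  choose q hq using hθ
  have hg : ∀ x y, θ (q x) y ≠ 0 → θ' (q y) y / θ (q y) y = θ' (q x) y / θ (q x) y := by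
    intro x y hxy
    rw [div_eq_div_iff (hq y) hxy, mul_comm, hcross, mul_comm]
  refine ⟨⟨fun x => θ' (q x) x / θ (q x) x, fun x => ?_⟩, ?_⟩
  · refine (((θ' (q x)).contMDiff x).div₀ ((θ (q x)).contMDiff x) (hq x)).congr_of_eventuallyEq ?_
    filter_upwards [(θ (q x)).contMDiff.continuous.continuousAt.eventually_ne (hq x)] with y hy
    exact hg x y hy
  · ext p x
    change θ' p x = θ' (q x) x / θ (q x) x * θ p x
    rw [div_mul_eq_mul_div, eq_div_iff (hq x), mul_comm, hcross, mul_comm]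

/-- The trace of an endomorphism in a partial dual basis is `χ t`. -/
def HasLocalTrace (n : ℕ) (S : P →ₗ[C^∞⟮I, M; ℝ⟯] P) (t : C^∞⟮I, M; ℝ⟯) : Prop :=
  ∀ x : M, ∃ B : PartialDualBasis C^∞⟮I, M; ℝ⟯ P n, B.χ x ≠ 0 ∧
    (∑ i, B.ε i (S (B.e i))) x = B.χ x * t x

theorem HasLocalTrace.dualMap {S : P →ₗ[C^∞⟮I, M; ℝ⟯] P} {t : C^∞⟮I, M; ℝ⟯}
    (h : HasLocalTrace n S t) : HasLocalTrace n S.dualMap t := fun x =>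
  let ⟨B, hB, hS⟩ := h x
  ⟨B.dual, hB, hS⟩

theorem HasLocalTrace.sum_update {S : P →ₗ[C^∞⟮I, M; ℝ⟯] P} {t : C^∞⟮I, M; ℝ⟯}
    (h : HasLocalTrace n S t) (θ : P [⋀^Fin n]→ₗ[C^∞⟮I, M; ℝ⟯] C^∞⟮I, M; ℝ⟯) (p : Fin n → P) :
    ∑ i, θ (Function.update p i (S (p i))) = t * θ p := by
  ext x
  obtain ⟨B, hB, hS⟩ := h x
  have h1 := congrArg (fun f : C^∞⟮I, M; ℝ⟯ => f x) (B.pow_mul_sum_update θ S p)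
  simp only [ContMDiffMap.coe_mul, Pi.mul_apply, ContMDiffMap.pow_apply_real, hS] at h1
  refine mul_left_cancel₀ (mul_ne_zero (pow_ne_zero n hB) hB) ?_
  simp only [ContMDiffMap.coe_mul, Pi.mul_apply]
  rw [h1]
  ring

theorem HasLocalTrace.neg {S : P →ₗ[C^∞⟮I, M; ℝ⟯] P} {t : C^∞⟮I, M; ℝ⟯}
    (h : HasLocalTrace n S t) : HasLocalTrace n (-S) (-t) := fun x => by
  obtain ⟨B, hB, hS⟩ := h x
  refine ⟨B, hB, ?_⟩
  simp only [LinearMap.neg_apply, map_neg, Finset.sum_neg_distrib, ContMDiffMap.coe_neg,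
    Pi.neg_apply, hS, mul_neg]

theorem HasPartialDualBases.hasLocalTrace_smulRight (h : HasPartialDualBases I (M := M) P n)
    (φ : Module.Dual C^∞⟮I, M; ℝ⟯ P) (X : P) : HasLocalTrace n (φ.smulRight X) (φ X) := fun x => by
  obtain ⟨B, hB⟩ := h x
  refine ⟨B, hB, ?_⟩
  rw [B.sum_rankOne]
  rfl

/-- Two nonvanishing forms have a nonvanishing tensor product. -/
theorem TensorProduct.smul_tmul_injective {Q : Type*} [AddCommGroup Q] [Module C^∞⟮I, M; ℝ⟯ Q]
    {k : ℕ} {θ : P [⋀^Fin n]→ₗ[C^∞⟮I, M; ℝ⟯] C^∞⟮I, M; ℝ⟯}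
    {ζ : Q [⋀^Fin k]→ₗ[C^∞⟮I, M; ℝ⟯] C^∞⟮I, M; ℝ⟯} (hθ : θ.IsNonvanishing)
    (hζ : ζ.IsNonvanishing) :
    Function.Injective fun g : C^∞⟮I, M; ℝ⟯ => g • (θ ⊗ₜ[C^∞⟮I, M; ℝ⟯] ζ) := by
  intro g g' h
  ext x
  obtain ⟨p, hp⟩ := hθ x
  obtain ⟨q, hq⟩ := hζ x
  let evθ : (P [⋀^Fin n]→ₗ[C^∞⟮I, M; ℝ⟯] C^∞⟮I, M; ℝ⟯) →ₗ[C^∞⟮I, M; ℝ⟯] C^∞⟮I, M; ℝ⟯ :=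
    { toFun := fun κ => κ p, map_add' := fun _ _ => rfl, map_smul' := fun _ _ => rfl }
  let evζ : (Q [⋀^Fin k]→ₗ[C^∞⟮I, M; ℝ⟯] C^∞⟮I, M; ℝ⟯) →ₗ[C^∞⟮I, M; ℝ⟯] C^∞⟮I, M; ℝ⟯ :=
    { toFun := fun κ => κ q, map_add' := fun _ _ => rfl, map_smul' := fun _ _ => rfl }
  have h1 := congrArg (TensorProduct.lift
    ((LinearMap.mul C^∞⟮I, M; ℝ⟯ C^∞⟮I, M; ℝ⟯).compl₁₂ evθ evζ)) h
  simp only [map_smul, TensorProduct.lift.tmul, LinearMap.compl₁₂_apply, LinearMap.mul_apply',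
    smul_eq_mul] at h1
  exact mul_right_cancel₀ (mul_ne_zero hp hq) (congrArg (fun f : C^∞⟮I, M; ℝ⟯ => f x) h1)

end TopForms

namespace ModuleDerivation

variable {E : Type*} [NormedAddCommGroup E] [NormedSpace ℝ E]
  {H : Type*} [TopologicalSpace H] {I : ModelWithCorners ℝ E H}
  {M : Type*} [TopologicalSpace M] [ChartedSpace H M]
  {P : Type*} [AddCommGroup P] [Module C^∞⟮I, M; ℝ⟯ P] {n : ℕ}
  {D D' D'' : ModuleDerivation C^∞⟮I, M; ℝ⟯ P}

theorem dual_onForms_eq_smul_add {f t : C^∞⟮I, M; ℝ⟯} {S : P →ₗ[C^∞⟮I, M; ℝ⟯] P}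
    (hS : HasLocalTrace n S t) (hsymbol : D'.symbol = f • D.symbol)
    (hD : ∀ p, D'.toAddHom p = f • D.toAddHom p + S p)
    (η : Module.Dual C^∞⟮I, M; ℝ⟯ P [⋀^Fin n]→ₗ[C^∞⟮I, M; ℝ⟯] C^∞⟮I, M; ℝ⟯) :
    D'.dual.onForms η = f • D.dual.onForms η + t • η :=
  onForms_eq_smul_add (D := D.dual) (D' := D'.dual) (S := -S.dualMap) (θ := η) hsymbol
    (fun α => by
      refine LinearMap.ext fun p => ?_
      simp only [LinearMap.add_apply, LinearMap.smul_apply, LinearMap.neg_apply,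
        LinearMap.dualMap_apply, dual_apply, hD, hsymbol, map_add, map_smul, Derivation.smul_apply,
        smul_eq_mul]
      ring)
    (hS.dualMap.neg.sum_update η)

theorem dual_onForms_eq_add (hsymbol : D''.symbol = D.symbol + D'.symbol)
    (hD : ∀ p, D''.toAddHom p = D.toAddHom p + D'.toAddHom p) {k : ℕ}
    (η : Module.Dual C^∞⟮I, M; ℝ⟯ P [⋀^Fin k]→ₗ[C^∞⟮I, M; ℝ⟯] C^∞⟮I, M; ℝ⟯) :
    D''.dual.onForms η = D.dual.onForms η + D'.dual.onForms η :=
  onForms_eq_add η hsymbol fun α => by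
    refine LinearMap.ext fun p => ?_
    simp only [LinearMap.add_apply, dual_apply, hD, hsymbol, map_add, Derivation.add_apply]
    ring

end ModuleDerivation

section VectorFields

variable {E : Type*} [NormedAddCommGroup E] [NormedSpace ℝ E] [FiniteDimensional ℝ E]
  {H : Type*} [TopologicalSpace H] {I : ModelWithCorners ℝ E H}
  {M : Type*} [TopologicalSpace M] [ChartedSpace H M] [IsManifold I ∞ M]

theorem hasPartialDualBases_vectorFields [T2Space M] :
    HasPartialDualBases I (M := M) (SmoothVectorField I M) (Module.finrank ℝ E) := fun x => by
  have : IsManifold I ((∞ : ℕ∞ω) + 1) M := ‹IsManifold I ∞ M›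
  have : ContMDiffVectorBundle ∞ E (TangentSpace I : M → Type _) I := inferInstance
  obtain ⟨B, hB, -⟩ := exists_partialDualBasis_sections (I := I) (F := E)
    (V := (TangentSpace I : M → Type _)) x
  exact ⟨B, hB⟩

namespace SmoothVectorField

omit [FiniteDimensional ℝ E] in
theorem derivation_smul (f : C^∞⟮I, M; ℝ⟯) (X : SmoothVectorField I M) :
    (f • X).derivation = f • X.derivation := by
  ext g x
  exact map_smul (mvfderiv I g x) (f x) (X x)

omit [FiniteDimensional ℝ E] in
theorem derivation_add (X Y : SmoothVectorField I M) :
    (X + Y).derivation = X.derivation + Y.derivation := by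
  ext g x
  exact map_add (mvfderiv I g x) (X x) (Y x)

/-- The differential of a function. -/
def differential (f : C^∞⟮I, M; ℝ⟯) : Module.Dual C^∞⟮I, M; ℝ⟯ (SmoothVectorField I M) where
  toFun X := X.derivation f
  map_add' X Y := by rw [derivation_add]; rfl
  map_smul' g X := by rw [derivation_smul]; rfl

theorem lieDerivative_smul [T2Space M] (f : C^∞⟮I, M; ℝ⟯) (X : SmoothVectorField I M)
    (μ : DifferentialForm I M (Module.finrank ℝ E)) :
    (f • X).lieDerivative μ = f • X.lieDerivative μ + X.derivation f • μ := by
  have hS := (hasPartialDualBases_vectorFields.hasLocalTrace_smulRight (differential f) X).neg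
  exact ModuleDerivation.onForms_eq_smul_add (D := X.ad) (D' := (f • X).ad) (θ := μ)
    (derivation_smul f X) (fun Y => by
      ext x
      refine (VectorField.mlieBracket_smul_left (f.contMDiff.mdifferentiable (by simp) x)
        (X.contMDiff.mdifferentiable (by simp) x)).trans ?_
      rw [add_comm, neg_smul]
      rfl) (hS.sum_update μ)

theorem lieDerivative_add (X Y : SmoothVectorField I M) {k : ℕ} (μ : DifferentialForm I M k) :
    (X + Y).lieDerivative μ = X.lieDerivative μ + Y.lieDerivative μ :=
  ModuleDerivation.onForms_eq_add μ (derivation_add X Y) fun Z => by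
    ext x
    exact VectorField.mlieBracket_add_left (X.contMDiff.mdifferentiable (by simp) x)
      (Y.contMDiff.mdifferentiable (by simp) x)

end SmoothVectorField

end VectorFields

namespace LieAlgebroid

set_option linter.unusedSectionVars false

variable {E : Type*} [NormedAddCommGroup E] [NormedSpace ℝ E] [FiniteDimensional ℝ E]
  {H : Type*} [TopologicalSpace H] {I : ModelWithCorners ℝ E H}
  {M : Type*} [TopologicalSpace M] [ChartedSpace H M] [IsManifold I ∞ M]
  {F : Type*} [NormedAddCommGroup F] [NormedSpace ℝ F] [FiniteDimensional ℝ F]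
  {V : M → Type*} [TopologicalSpace (Bundle.TotalSpace F V)]
  [∀ x, AddCommGroup (V x)] [∀ x, Module ℝ (V x)] [∀ x, TopologicalSpace (V x)]
  [∀ x, IsTopologicalAddGroup (V x)] [∀ x, ContinuousSMul ℝ (V x)]
  [FiberBundle F V] [VectorBundle ℝ F V] [ContMDiffVectorBundle ∞ F V I]
  (A : LieAlgebroid I F V)

theorem hasPartialDualBases_sections [T2Space M] :
    HasPartialDualBases I (M := M) Cₛ^∞⟮I; F, V⟯ (Module.finrank ℝ F) := fun x =>
  let ⟨B, hB, _⟩ := exists_partialDualBasis_sections (I := I) (F := F) (V := V) x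
  ⟨B, hB⟩

theorem hasLocalTrace_commutator [T2Space M]
    (D : ModuleDerivation C^∞⟮I, M; ℝ⟯ Cₛ^∞⟮I; F, V⟯) (N : BundleEnd I F V) :
    HasLocalTrace (Module.finrank ℝ F) (D.commutator N.onSections) (D.symbol N.trace) := by
  intro x
  obtain ⟨B, hB, htrace⟩ := exists_partialDualBasis_sections (I := I) (F := F) (V := V) x
  refine ⟨B, hB, mul_left_cancel₀ hB ?_⟩
  exact congrArg (fun f : C^∞⟮I, M; ℝ⟯ => f x) (D.mul_sum_commutator B N.onSections _ (htrace N))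

theorem anchorField_smul (f : C^∞⟮I, M; ℝ⟯) (X : Cₛ^∞⟮I; F, V⟯) :
    A.anchorField (f • X) = f • A.anchorField X := by
  ext x
  exact map_smul (A.anchor x) (f x) (X x)

theorem anchorField_add (X Y : Cₛ^∞⟮I; F, V⟯) :
    A.anchorField (X + Y) = A.anchorField X + A.anchorField Y := by
  ext x
  exact map_add (A.anchor x) (X x) (Y x)

theorem bracket_smul_left (f : C^∞⟮I, M; ℝ⟯) (X Y : Cₛ^∞⟮I; F, V⟯) :
    A.bracket (f • X) Y = f • A.bracket X Y + -(A.d f Y • X) := by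
  have h : A.bracket Y (f • X) = f • A.bracket Y X + A.d f Y • X := (A.ad Y).leibniz f X
  rw [A.bracket_skew, h, A.bracket_skew Y X, smul_neg]
  abel

theorem lieDerivative_smul [T2Space M] (f : C^∞⟮I, M; ℝ⟯) (X : Cₛ^∞⟮I; F, V⟯)
    (η : A.Multivectors (Module.finrank ℝ F)) :
    A.lieDerivative (f • X) η = f • A.lieDerivative X η + -A.d f X • η :=
  ModuleDerivation.dual_onForms_eq_smul_add (D := A.ad X) (D' := A.ad (f • X))
    (hasPartialDualBases_sections.hasLocalTrace_smulRight (A.d f) X).neg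
    ((congrArg SmoothVectorField.derivation (A.anchorField_smul f X)).trans
      (SmoothVectorField.derivation_smul f _)) (A.bracket_smul_left f X) η

theorem lieDerivative_add (X Y : Cₛ^∞⟮I; F, V⟯) {k : ℕ} (η : A.Multivectors k) :
    A.lieDerivative (X + Y) η = A.lieDerivative X η + A.lieDerivative Y η :=
  ModuleDerivation.dual_onForms_eq_add (D := A.ad X) (D' := A.ad Y) (D'' := A.ad (X + Y))
    ((congrArg SmoothVectorField.derivation (A.anchorField_add X Y)).trans
      (SmoothVectorField.derivation_add _ _))
    (fun Z => by
      change A.bracket (X + Y) Z = A.bracket X Z + A.bracket Y Z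
      rw [map_add, LinearMap.add_apply]) η

/-- The deformed Lie derivative of top degree multivector fields. -/
theorem deform_lieDerivative [T2Space M] (N : BundleEnd I F V) (hN : A.IsNijenhuis N)
    (X : Cₛ^∞⟮I; F, V⟯) (η : A.Multivectors (Module.finrank ℝ F)) :
    (A.deform N hN).lieDerivative X η =
      A.lieDerivative (N.onSections X) η + A.d N.trace X • η := by
  have h := ModuleDerivation.dual_onForms_eq_smul_add (D := A.ad (N.onSections X))
    (D' := (A.deform N hN).ad X) (f := 1) (hasLocalTrace_commutator (A.ad X) N)
    (by rw [one_smul]; rfl)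
    (fun Y => by
      rw [one_smul]
      exact add_sub_assoc _ _ _) η
  rw [one_smul] at h
  exact h

variable {A} {η : A.Multivectors (Module.finrank ℝ F)}
  {μ : DifferentialForm I M (Module.finrank ℝ E)}

theorem IsModularForm.eq {ξ ξ' : A.OneForms} (hη : η.IsNonvanishing) (hμ : μ.IsNonvanishing)
    (h : A.IsModularForm η μ ξ) (h' : A.IsModularForm η μ ξ') : ξ = ξ' :=
  LinearMap.ext fun X => TensorProduct.smul_tmul_injective hη hμ ((h X).trans (h' X).symm)

theorem exists_isModularForm [T2Space M] (hη : η.IsNonvanishing) (hμ : μ.IsNonvanishing) :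
    ∃ ξ : A.OneForms, A.IsModularForm η μ ξ := by
  have hex : ∀ X, ∃ g : C^∞⟮I, M; ℝ⟯, g • (η ⊗ₜ[C^∞⟮I, M; ℝ⟯] μ) =
      A.lieDerivative X η ⊗ₜ[C^∞⟮I, M; ℝ⟯] μ +
        η ⊗ₜ[C^∞⟮I, M; ℝ⟯] (A.anchorField X).lieDerivative μ := fun X => by
    obtain ⟨a, ha⟩ := hη.exists_eq_smul hasPartialDualBases_sections.dual (A.lieDerivative X η)
    obtain ⟨b, hb⟩ := hμ.exists_eq_smul hasPartialDualBases_vectorFields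
      ((A.anchorField X).lieDerivative μ)
    refine ⟨a + b, ?_⟩
    rw [ha, hb, add_smul, TensorProduct.smul_tmul', TensorProduct.tmul_smul]
  choose g hg using hex
  have hinj := TensorProduct.smul_tmul_injective hη hμ
  refine ⟨⟨⟨g, fun X Y => hinj ?_⟩, fun f X => hinj ?_⟩, hg⟩
  · simp only [add_smul, hg, A.lieDerivative_add, A.anchorField_add,
      SmoothVectorField.lieDerivative_add, TensorProduct.add_tmul, TensorProduct.tmul_add]
    abel
  · have hd : (A.anchorField X).derivation f = A.d f X := rfl
    have hcancel : -A.d f X • (η ⊗ₜ[C^∞⟮I, M; ℝ⟯] μ) + A.d f X • (η ⊗ₜ[C^∞⟮I, M; ℝ⟯] μ) = 0 := by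
      rw [← add_smul, neg_add_cancel, zero_smul]
    simp only [smul_eq_mul, mul_smul, RingHom.id_apply, hg, A.lieDerivative_smul,
      A.anchorField_smul, SmoothVectorField.lieDerivative_smul, TensorProduct.add_tmul,
      TensorProduct.tmul_add, TensorProduct.tmul_smul, ← TensorProduct.smul_tmul', hd, smul_add]
    rw [add_add_add_comm, hcancel, add_zero]

theorem IsModularForm.deform [T2Space M] {N : BundleEnd I F V} (hN : A.IsNijenhuis N)
    {ξ : A.OneForms} (h : A.IsModularForm η μ ξ) :
    (A.deform N hN).IsModularForm η μ (A.d N.trace + N.transpose ξ) := fun X => by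
  have hX := h (N.onSections X)
  have hρ : (A.deform N hN).anchorField X = A.anchorField (N.onSections X) := rfl
  rw [deform_lieDerivative, hρ, TensorProduct.add_tmul, ← TensorProduct.smul_tmul', add_right_comm,
    ← hX, ← add_smul, add_comm (ξ _)]
  rfl

end LieAlgebroid

end

theorem mainTheorem2
    {E : Type*} [NormedAddCommGroup E] [NormedSpace ℝ E] [FiniteDimensional ℝ E]
    {H : Type*} [TopologicalSpace H] {I : ModelWithCorners ℝ E H} [I.Boundaryless]
    {M : Type*} [TopologicalSpace M] [ChartedSpace H M] [IsManifold I ∞ M]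
    [T2Space M] [SecondCountableTopology M]
    {F : Type*} [NormedAddCommGroup F] [NormedSpace ℝ F] [FiniteDimensional ℝ F]
    {V : M → Type*} [TopologicalSpace (Bundle.TotalSpace F V)]
    [∀ x, AddCommGroup (V x)] [∀ x, Module ℝ (V x)] [∀ x, TopologicalSpace (V x)]
    [∀ x, IsTopologicalAddGroup (V x)] [∀ x, ContinuousSMul ℝ (V x)]
    [FiberBundle F V] [VectorBundle ℝ F V] [ContMDiffVectorBundle ∞ F V I]
    (A : LieAlgebroid I F V) (N : BundleEnd I F V) (hN : A.IsNijenhuis N) :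
    (∀ (η : A.Multivectors (Module.finrank ℝ F)) (μ : DifferentialForm I M (Module.finrank ℝ E)),
      η.IsNonvanishing → μ.IsNonvanishing →
        (∃! ξ : A.OneForms, A.IsModularForm η μ ξ) ∧
        (∃! ξN : A.OneForms, (A.deform N hN).IsModularForm η μ ξN) ∧
        ∀ ξ ξN : A.OneForms, A.IsModularForm η μ ξ → (A.deform N hN).IsModularForm η μ ξN →
          ξN = A.d N.trace + N.transpose ξ) ∧
    (∀ (η η' : A.Multivectors (Module.finrank ℝ F))
      (μ μ' : DifferentialForm I M (Module.finrank ℝ E)),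
      η.IsNonvanishing → μ.IsNonvanishing → η'.IsNonvanishing → μ'.IsNonvanishing →
        ∀ ξ ξN ξ' ξN' : A.OneForms,
          A.IsModularForm η μ ξ → (A.deform N hN).IsModularForm η μ ξN →
          A.IsModularForm η' μ' ξ' → (A.deform N hN).IsModularForm η' μ' ξN' →
            ξN - N.transpose ξ = ξN' - N.transpose ξ') := by
  have key : ∀ (η : A.Multivectors (Module.finrank ℝ F))
      (μ : DifferentialForm I M (Module.finrank ℝ E)), η.IsNonvanishing → μ.IsNonvanishing →
      ∀ ξ ξN : A.OneForms, A.IsModularForm η μ ξ → (A.deform N hN).IsModularForm η μ ξN →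
        ξN = A.d N.trace + N.transpose ξ :=
    fun η μ hη hμ ξ ξN h hN' =>
      LieAlgebroid.IsModularForm.eq (A := A.deform N hN) hη hμ hN' (h.deform hN)
  refine ⟨fun η μ hη hμ => ⟨?_, ?_, key η μ hη hμ⟩,
    fun η η' μ μ' hη hμ hη' hμ' ξ ξN ξ' ξN' h hd h' hd' => ?_⟩
  · obtain ⟨ξ, h⟩ := LieAlgebroid.exists_isModularForm (A := A) hη hμ
    exact ⟨ξ, h, fun ξ' h' => h'.eq hη hμ h⟩
  · obtain ⟨ξ, h⟩ := LieAlgebroid.exists_isModularForm (A := A.deform N hN) hη hμ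
    exact ⟨ξ, h, fun ξ' h' => LieAlgebroid.IsModularForm.eq (A := A.deform N hN) hη hμ h' h⟩
  · rw [key η μ hη hμ ξ ξN h hd, key η' μ' hη' hμ' ξ' ξN' h' hd', add_sub_cancel_right,
      add_sub_cancel_right]
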